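/- **Setting.** Let $k\ge 0$. An *additive noise model* (ANM) with DAG $\mathcal G$ on $\{1,\dots,k\}$ is a structural equation model $C_j=f_j(C_{\mathrm{pa}(j)})+\varepsilon_j$, $j=1,\dots,k$, with continuous functions $f_j$ and jointly independent noise variables $\varepsilon_j$ having continuous, strictly positive densities $p_j$ on $\mathbb R$. Its joint density is $p(x)=\prod_j p_j(x_j-f_j(x_{\mathrm{pa}(j)}))$; for $S\subseteq\{1,\dots,k\}$, $p_S$ denotes the marginal density obtained by integrating out the variables outside $S$ (pointwise), and $p(x_i\mid x_S)=p_{S\cup\{i\}}(x_S,x_i)/p_S(x_S)$. The ANM is *restricted* if every $f_j$ is three times continuously differentiable and for every edge $i\to j$ of $\mathcal G$ and every set $S$ with $\mathrm{pa}(j)\setminus\{i\}\subseteq S\subseteq \mathrm{nd}(j)\setminus\{i,j\}$ (where $\mathrm{nd}(j)$ is the set of non-descendants of $j$) there is a point $x_S$ with $0<p_S(x_S)<\infty$ such that the triple consisting of $f=f_j(x_{\mathrm{pa}(j)\setminus\{i\}},\cdot)$, the density $x\mapsto p(x_i=x\mid x_S)$ and the density $p_j$ has the following property: both densities are strictly positive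 and, together with $f$, three times continuously differentiable; and, with $\xi=\log p(x_i=\cdot\mid x_S)$ and $\nu=\log p_j$, the equation $$\xi'''=\xi''\Bigl(-\frac{\nu'''f'}{\nu''}+\frac{f''}{f'}\Bigr)-2\nu''f''f'+\nu'f'''+\frac{\nu'\nu'''f''f'}{\nu''}-\frac{\nu'(f'')^2}{f'}$$ (with $\xi,f$ and their derivatives taken at $x$, and $\nu$ and its derivatives at $y-f(x)$) fails for at least one pair $(x,y)\in\mathbb R^2$ with $\nu''(y-f(x))f'(x)\ne0$. **Proposition.** Suppose that $C=(C_1,\dots,C_k)$ is generated by a restricted ANM with DAG $\mathcal G$, and let $P(C)$ be its distribution. Let $A\in\{0,1\}^{k\times k}$ be the adjacency matrix of a DAG $\mathcal H$ ($A_{ij}=1$ iff $i\to j$ in $\mathcal H$), with columns $A_j=(A_{1j},\dots,A_{kj})$, and suppose that the parameterized structural equation model $$C_j=g_j(A_j\odot C)+\varepsilon'_j,\qquad j=1,\dots,k,$$ with continuous functions $g_j:\mathbb R^k\to\mathbb R$ (non-constant or not) and jointly independent noise variables $\varepsilon_j'$ having continuous, strictly positive densities, induces the same distribution $P(C)$.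 Then $\mathcal H$ is a super-graph of $\mathcal G$: every edge of $\mathcal G$ is an edge of $\mathcal H$. -/

import Mathlib

open MeasureTheory ProbabilityTheory
open scoped ENNReal

/-- A directed graph is acyclic (a DAG) if no vertex can be reached from itself along a directed
path of positive length. -/
def Digraph.IsDAG {V : Type*} (G : Digraph V) : Prop :=
  ∀ v, ¬ Relation.TransGen G.Adj v v

/-- A (strictly positive, continuous) probability density on the real line. -/
structure IsPosDensity (p : ℝ → ℝ) : Prop where
  continuous : Continuous p
  pos : ∀ x, 0 < p x
  lintegral_eq_one : ∫⁻ x, ENNReal.ofReal (p x) = 1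

/-- An additive noise model `C_j = f_j(C_{pa(j)}) + ε_j`, `j = 1, …, k`, over a DAG.
`graph.Adj i j` means that `i` is a parent of `j`. The function `f j` is written as a function of
the whole vector that only depends on the coordinates belonging to parents of `j`. -/
structure AdditiveNoiseModel (k : ℕ) where
  graph : Digraph (Fin k)
  isDAG : graph.IsDAG
  f : Fin k → (Fin k → ℝ) → ℝ
  continuous_f : ∀ j, Continuous (f j)
  f_congr : ∀ j x y, (∀ i, graph.Adj i j → x i = y i) → f j x = f j y
  noiseDensity : Fin k → ℝ → ℝ
  isPosDensity : ∀ j, IsPosDensity (noiseDensity j)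

/-- `(f, p, q)` satisfies the bivariate identifiability condition for the model `Y = f(X) + N`,
where `X` has density `p` and `N` has density `q`: with `ξ = log p` and `ν = log q`, everything is
three times continuously differentiable, and the triple does *not* solve the differential equation
`ξ''' = ξ''(-ν''' f'/ν'' + f''/f') - 2 ν'' f'' f' + ν' f''' + ν' ν''' f'' f'/ν'' - ν' (f'')²/f'`
at all `(x, y)` with `ν''(y - f(x)) f'(x) ≠ 0`, where `ν` and its derivatives are evaluated at
`y - f(x)`, and `ξ`, `f` and their derivatives at `x`. -/
def BivariateCondition (f p q : ℝ → ℝ) : Prop :=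
  (∀ x, 0 < p x) ∧ (∀ x, 0 < q x) ∧ ContDiff ℝ 3 f ∧ ContDiff ℝ 3 p ∧ ContDiff ℝ 3 q ∧
  let ξ : ℕ → ℝ → ℝ := fun n => iteratedDeriv n (fun x => Real.log (p x))
  let ν : ℕ → ℝ → ℝ := fun n => iteratedDeriv n (fun x => Real.log (q x))
  let φ : ℕ → ℝ → ℝ := fun n => iteratedDeriv n f
  ¬ ∀ x y : ℝ, ν 2 (y - f x) * φ 1 x ≠ 0 →
    ξ 3 x =
      ξ 2 x * (-(ν 3 (y - f x) * φ 1 x / ν 2 (y - f x)) + φ 2 x / φ 1 x)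
        - 2 * ν 2 (y - f x) * φ 2 x * φ 1 x
        + ν 1 (y - f x) * φ 3 x
        + ν 1 (y - f x) * ν 3 (y - f x) * φ 2 x * φ 1 x / ν 2 (y - f x)
        - ν 1 (y - f x) * φ 2 x ^ 2 / φ 1 x

namespace AdditiveNoiseModel

variable {k : ℕ}

/-- The random vector `C` is generated by the model `M`: it solves the structural equations
`C_j = f_j(C) + ε_j` for jointly independent noise variables `ε_j` with the given densities. -/
def Generates (M : AdditiveNoiseModel k) {Ω : Type*} [MeasurableSpace Ω] (μ : Measure Ω)
    (C : Ω → Fin k → ℝ) : Prop :=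
  Measurable C ∧ ∃ ε : Fin k → Ω → ℝ,
    (∀ j, Measurable (ε j)) ∧ iIndepFun ε μ ∧
    (∀ j, μ.map (ε j) = volume.withDensity fun t => ENNReal.ofReal (M.noiseDensity j t)) ∧
    ∀ᵐ ω ∂μ, ∀ j, C ω j = M.f j (C ω) + ε j ω

/-- The joint density `x ↦ ∏_j p_j(x_j - f_j(x))` of the variables of the model. -/
noncomputable def jointDensity (M : AdditiveNoiseModel k) (x : Fin k → ℝ) : ℝ≥0∞ :=
  ENNReal.ofReal (∏ j, M.noiseDensity j (x j - M.f j x))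

/-- The density of the subvector `C_S`, at the coordinates `x_i`, `i ∈ S`, of `x`: all other
variables are integrated out. -/
noncomputable def marginalDensity (M : AdditiveNoiseModel k) (S : Finset (Fin k))
    (x : Fin k → ℝ) : ℝ≥0∞ :=
  lmarginal (fun _ => volume) Sᶜ M.jointDensity x

/-- The density `t ↦ p(C_i = t | C_S = x_S)` of `C_i` given `C_S = x_S`, for `i ∉ S`. -/
noncomputable def condDensity (M : AdditiveNoiseModel k) (i : Fin k) (S : Finset (Fin k))
    (x : Fin k → ℝ) (t : ℝ) : ℝ :=
  (M.marginalDensity (insert i S) (Function.update x i t) / M.marginalDensity S x).toReal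

/-- Restricted additive noise models: the `f_j` are three times continuously differentiable, and
for every edge `i → j` and every set `S` of non-descendants of `j` (not containing `i`, `j`) that
contains all other parents of `j`, there is a point `x_S` of positive density such that
`(f_j(x_{pa(j) ∖ {i}}, ·), law of C_i given C_S = x_S, law of ε_j)` satisfies the bivariate
identifiability condition. -/
def IsRestricted (M : AdditiveNoiseModel k) : Prop :=
  (∀ j, ContDiff ℝ 3 (M.f j)) ∧
  ∀ i j, M.graph.Adj i j → ∀ S : Finset (Fin k),
    (∀ m, M.graph.Adj m j → m ≠ i → m ∈ S) →
    (∀ m ∈ S, m ≠ i ∧ m ≠ j ∧ ¬ Relation.TransGen M.graph.Adj j m) →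
    ∃ x : Fin k → ℝ, 0 < M.marginalDensity S x ∧ M.marginalDensity S x < ∞ ∧
      BivariateCondition (fun t => M.f j (Function.update x i t)) (M.condDensity i S x)
        (M.noiseDensity j)

end AdditiveNoiseModel

/-- The parameterized model `C_j = g_j(A_j ⊙ C) + ε_j`, where `A` is the binary adjacency matrix of
a DAG and `A_j = (A_{1j}, …, A_{kj})` indicates the parents of `j`. -/
structure MaskedModel (k : ℕ) where
  A : Matrix (Fin k) (Fin k) ℝ
  binary : ∀ i j, A i j = 0 ∨ A i j = 1
  g : Fin k → (Fin k → ℝ) → ℝ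
  continuous_g : ∀ j, Continuous (g j)
  noiseDensity : Fin k → ℝ → ℝ
  isPosDensity : ∀ j, IsPosDensity (noiseDensity j)
  isDAG : Digraph.IsDAG ⟨fun i j => A i j = 1⟩

namespace MaskedModel

variable {k : ℕ}

/-- The DAG with adjacency matrix `A`. -/
def graph (N : MaskedModel k) : Digraph (Fin k) := ⟨fun i j => N.A i j = 1⟩

/-- The structural equations of the parameterized model. -/
def toAdditiveNoiseModel (N : MaskedModel k) : AdditiveNoiseModel k where
  graph := N.graph
  isDAG := N.isDAG
  f j x := N.g j fun i => N.A i j * x i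
  continuous_f j := (N.continuous_g j).comp (by fun_prop)
  f_congr j x y h := by
    congr 1
    funext i
    rcases N.binary i j with h0 | h1
    · simp [h0]
    · rw [h i h1]
  noiseDensity := N.noiseDensity
  isPosDensity := N.isPosDensity

end MaskedModel

/-! Edges on which the functions of the second model do not depend may be deleted (`prune`), so let
`N` be the pruned model. Both joint densities are continuous, hence equal everywhere, and each is a
product of one factor per vertex. The edges of `M` are found in `N` by induction on a vertex set
`V`, closed under parents in both graphs, over which the two products agree.

Let `l` be a sink of `M` in `V`. If `l` is also childless in `N`, a dependence of `f_l` on `x_i`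
must show up in the product for `N` (`exists_involves`): otherwise that product would split into a
part free of `x_i` and a part free of `x_l`, making two distinct translates of the noise density
proportional. Only the factor of `l` in `N` can contain both variables, so `i → l` in `N`.
Integrating out `x_l` then removes `l`.

If `l` has a child in `N`, take a last such child `y`. The same argument with the models exchanged
gives `y → l` in `M`, an edge that `N` reverses. Conditioning on the other parents of both ends
turns this into a bivariate model invertible in both directions (`not_adj_reverse`). Differentiating
its log density yields the differential equation that restricted models exclude
(`not_bivariateCondition_of_backward`). -/

/-! ### Bivariate identifiability -/

theorem ContDiff.hasDerivAt_iteratedDeriv {f : ℝ → ℝ} {n : ℕ} (hf : ContDiff ℝ n f) {m : ℕ}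
    (hm : m < n) (x : ℝ) : HasDerivAt (iteratedDeriv m f) (iteratedDeriv (m + 1) f x) x := by
  rw [iteratedDeriv_succ]
  exact (hf.differentiable_iteratedDeriv m (by exact_mod_cast hm) x).hasDerivAt

/-- If `ρ (x - g t)` is, as a function of `t`, differentiable at `y` for one `x` such that `ρ` has
non-zero strict derivative at `x - g y`, then the continuous function `g` is differentiable. -/
theorem differentiableAt_of_hasStrictDerivAt_comp_sub {ρ g h : ℝ → ℝ} {x y c : ℝ}
    (hg : ContinuousAt g y) (hρ : HasStrictDerivAt ρ c (x - g y)) (hc : c ≠ 0)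
    (hh : DifferentiableAt ℝ h y) (heq : ∀ t, ρ (x - g t) = h t) : DifferentiableAt ℝ g y := by
  have hcont : ContinuousAt (fun t => x - g t) y := continuousAt_const.sub hg
  have hinv := hcont.eventually (hρ.eventually_left_inverse hc)
  have hd : DifferentiableAt ℝ (hρ.localInverse ρ c (x - g y) hc) (h y) := by
    rw [← heq]
    exact (hρ.to_localInverse hc).hasDerivAt.differentiableAt
  have hd' : DifferentiableAt ℝ (fun t => x - hρ.localInverse ρ c (x - g y) hc (h t)) y :=
    (differentiableAt_const x).sub (hd.comp y hh)
  refine hd'.congr_of_eventuallyEq ?_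
  filter_upwards [hinv] with t ht
  rw [← heq, ht]
  ring

/-- A bivariate additive noise model satisfying the identifiability condition admits no additive
noise model with continuous function in the backward direction. -/
theorem not_bivariateCondition_of_backward {f p q g r η : ℝ → ℝ} (hg : Continuous g)
    (hr : ∀ u, 0 < r u) (h : ∀ s t, p s * q (t - f s) = η t * r (s - g t)) :
    ¬ BivariateCondition f p q := by
  rintro ⟨hp, hq, hf3, hp3, hq3, hODE⟩
  apply hODE
  clear hODE
  intro x y hxy
  set ξ : ℕ → ℝ → ℝ := fun n => iteratedDeriv n (fun x => Real.log (p x))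
  set ν : ℕ → ℝ → ℝ := fun n => iteratedDeriv n (fun x => Real.log (q x))
  set φ : ℕ → ℝ → ℝ := fun n => iteratedDeriv n f
  set ρ : ℕ → ℝ → ℝ := fun n => iteratedDeriv n (fun x => Real.log (r x))
  have hη : ∀ t, 0 < η t := fun t =>
    pos_of_mul_pos_left (h 0 t ▸ mul_pos (hp 0) (hq _)) (hr _).le
  have hlog : ∀ s t, ξ 0 s + ν 0 (t - φ 0 s) = Real.log (η t) + ρ 0 (s - g t) := by
    intro s t
    have := congrArg Real.log (h s t)
    rw [Real.log_mul (hp _).ne' (hq _).ne', Real.log_mul (hη _).ne' (hr _).ne'] at this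
    simpa [ξ, ν, ρ, φ] using this
  have hξ3 : ContDiff ℝ 3 (fun x => Real.log (p x)) := hp3.log fun x => (hp x).ne'
  have hν3 : ContDiff ℝ 3 (fun x => Real.log (q x)) := hq3.log fun x => (hq x).ne'
  -- The smoothness of `log r` is inherited: put `t = 0` in `hlog`.
  have hρ3 : ContDiff ℝ 3 (fun x => Real.log (r x)) := by
    have : (fun x => Real.log (r x)) = fun u =>
        Real.log (p (u + g 0)) + Real.log (q (0 - f (u + g 0))) - Real.log (η 0) := by
      funext u
      have := hlog (u + g 0) 0
      simp only [ξ, ν, ρ, φ, iteratedDeriv_zero, add_sub_cancel_right] at this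
      linarith
    rw [this]
    have hsh : ContDiff ℝ 3 (fun u : ℝ => u + g 0) := contDiff_id.add contDiff_const
    exact ((hξ3.comp hsh).add (hν3.comp (contDiff_const.sub (hf3.comp hsh)))).sub contDiff_const
  have dξ : ∀ m < 3, ∀ x, HasDerivAt (ξ m) (ξ (m + 1) x) x := fun m hm x =>
    hξ3.hasDerivAt_iteratedDeriv hm x
  have dν : ∀ m < 3, ∀ x, HasDerivAt (ν m) (ν (m + 1) x) x := fun m hm x =>
    hν3.hasDerivAt_iteratedDeriv hm x
  have dρ : ∀ m < 3, ∀ x, HasDerivAt (ρ m) (ρ (m + 1) x) x := fun m hm x =>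
    hρ3.hasDerivAt_iteratedDeriv hm x
  have dφ : ∀ m < 3, ∀ x, HasDerivAt (φ m) (φ (m + 1) x) x := fun m hm x =>
    hf3.hasDerivAt_iteratedDeriv hm x
  have dνφ : ∀ m < 3, ∀ s t, HasDerivAt (fun s => ν m (t - φ 0 s))
      (-(ν (m + 1) (t - φ 0 s) * φ 1 s)) s := fun m hm s t => by
    have := (dν m hm (t - φ 0 s)).comp s ((dφ 0 (by norm_num) s).const_sub t)
    simpa [Function.comp_def] using this
  have dρg : ∀ m < 3, ∀ s t, HasDerivAt (fun s => ρ m (s - g t)) (ρ (m + 1) (s - g t)) s :=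
    fun m hm s t => (dρ m hm (s - g t)).comp_sub_const s (g t)
  -- Differentiating in `s` first removes `η`, so no regularity of `η` is needed.
  have e1 : ∀ s t, ξ 1 s - ν 1 (t - φ 0 s) * φ 1 s = ρ 1 (s - g t) := by
    intro s t
    have l := (dξ 0 (by norm_num) s).add (dνφ 0 (by norm_num) s t)
    have r' := (dρg 0 (by norm_num) s t).const_add (Real.log (η t))
    have := l.unique (r'.congr_of_eventuallyEq (.of_forall fun s => hlog s t))
    linarith
  have e2 : ∀ s t, ξ 2 s + ν 2 (t - φ 0 s) * φ 1 s ^ 2 - ν 1 (t - φ 0 s) * φ 2 s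
      = ρ 2 (s - g t) := by
    intro s t
    have l := (dξ 1 (by norm_num) s).sub
      ((dνφ 1 (by norm_num) s t).mul (dφ 1 (by norm_num) s))
    have := l.unique ((dρg 1 (by norm_num) s t).congr_of_eventuallyEq
      (.of_forall fun s => e1 s t))
    rw [← this]
    ring
  have e3 : ∀ s t, ξ 3 s - ν 3 (t - φ 0 s) * φ 1 s ^ 3 + 3 * ν 2 (t - φ 0 s) * φ 1 s * φ 2 s
      - ν 1 (t - φ 0 s) * φ 3 s = ρ 3 (s - g t) := by
    intro s t
    have l := ((dξ 2 (by norm_num) s).add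
      ((dνφ 2 (by norm_num) s t).mul ((dφ 1 (by norm_num) s).pow 2))).sub
      ((dνφ 1 (by norm_num) s t).mul (dφ 2 (by norm_num) s))
    have := l.unique ((dρg 2 (by norm_num) s t).congr_of_eventuallyEq
      (.of_forall fun s => e2 s t))
    rw [← this]
    simp
    ring
  have dt : ∀ s, HasDerivAt (fun t => ξ 1 s - ν 1 (t - φ 0 s) * φ 1 s)
      (-(ν 2 (y - φ 0 s) * φ 1 s)) y := fun s =>
    (((dν 1 (by norm_num) (y - φ 0 s)).comp_sub_const y (φ 0 s)).mul_const (φ 1 s)).const_sub _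
  have hφ0 : ∀ x, φ 0 x = f x := fun x => by simp [φ]
  -- Otherwise `ρ 1` is constant, and the `t`-derivative of `e1` contradicts `hxy`.
  obtain ⟨u, hu⟩ : ∃ u, ρ 2 u ≠ 0 := by
    by_contra! hcon
    have hconst : ∀ a b, ρ 1 a = ρ 1 b := is_const_of_deriv_eq_zero
      (fun x => (dρ 1 (by norm_num) x).differentiableAt)
      (fun x => (dρ 1 (by norm_num) x).deriv.trans (hcon x))
    have h0 : HasDerivAt (fun t => ξ 1 x - ν 1 (t - φ 0 x) * φ 1 x) 0 y := by
      refine (hasDerivAt_const y (ρ 1 0)).congr_of_eventuallyEq (.of_forall fun t => ?_)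
      exact (e1 x t).trans (hconst _ _)
    have := (dt x).unique h0
    rw [hφ0] at this
    exact hxy (by linarith)
  have hgd : DifferentiableAt ℝ g y := by
    have hstrict : HasStrictDerivAt (ρ 1) (ρ 2 u) u := by
      have : ContDiff ℝ 1 (ρ 1) := by
        apply ContDiff.iterate_deriv' 1 1 _ |> fun h => by
          simpa [ρ, iteratedDeriv_eq_iterate] using h
        exact hρ3.of_le (by norm_num)
      have h1 := (this.contDiffAt (x := u)).hasStrictDerivAt (by norm_num)
      rwa [(dρ 1 (by norm_num) u).deriv] at h1
    -- The point `u + g y` makes the argument of `ρ 1` equal to `u`, where `ρ 1` is locally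
    -- invertible.
    refine differentiableAt_of_hasStrictDerivAt_comp_sub (x := u + g y) (c := ρ 2 u)
      hg.continuousAt ?_ hu (dt (u + g y)).differentiableAt fun t => (e1 _ t).symm
    simpa using hstrict
  obtain ⟨d, hd⟩ : ∃ d, HasDerivAt g d y := ⟨_, hgd.hasDerivAt⟩
  have e11 : ∀ s, ν 2 (y - φ 0 s) * φ 1 s = ρ 2 (s - g y) * d := by
    intro s
    have r' : HasDerivAt (fun t => ρ 1 (s - g t)) (ρ 2 (s - g y) * (-d)) y :=
      HasDerivAt.comp (h₂ := ρ 1) y (dρ 1 (by norm_num) (s - g y)) (hd.const_sub s)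
    have := (dt s).unique (r'.congr_of_eventuallyEq (.of_forall fun t => e1 s t))
    linarith
  have e21 : -ν 3 (y - φ 0 x) * φ 1 x ^ 2 + ν 2 (y - φ 0 x) * φ 2 x = ρ 3 (x - g y) * d := by
    have l := (dνφ 2 (by norm_num) x y).mul (dφ 1 (by norm_num) x)
    have := l.unique (((dρg 2 (by norm_num) x y).mul_const d).congr_of_eventuallyEq
      (.of_forall fun s => e11 s))
    rw [← this]
    ring
  have k1 := e11 x
  rw [← e2 x y] at k1
  rw [← e3 x y] at e21
  simp only [hφ0] at k1 e21
  have hn : ν 2 (y - f x) ≠ 0 := left_ne_zero_of_mul hxy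
  have hf1 : φ 1 x ≠ 0 := right_ne_zero_of_mul hxy
  generalize ν 1 (y - f x) = n1 at *
  generalize ν 2 (y - f x) = n2 at *
  generalize ν 3 (y - f x) = n3 at *
  generalize ξ 2 x = x2 at *
  generalize ξ 3 x = x3 at *
  generalize φ 1 x = f1 at *
  generalize φ 2 x = f2 at *
  generalize φ 3 x = f3 at *
  -- `A` and `B` are `ρ''` and `ρ'''` at `x - g y`; the unknown `d = g'(y)` is eliminated between
  -- `k1` and `e21`.
  set A := x2 + n2 * f1 ^ 2 - n1 * f2 with hA
  set B := x3 - n3 * f1 ^ 3 + 3 * n2 * f1 * f2 - n1 * f3 with hB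
  have key : B * (n2 * f1) = A * (-n3 * f1 ^ 2 + n2 * f2) := by
    rw [k1, e21]
    ring
  rw [hA, hB] at key
  field_simp
  linear_combination key

/-! ### Rigidity of translates of a density -/

/-- If two translates of a probability density are proportional, then they are equal. -/
theorem IsPosDensity.eq_of_mul_eq_mul {q : ℝ → ℝ} (hq : IsPosDensity q) {α β : ℝ}
    (h : ∀ u v, q (u - α) * q (v - β) = q (v - α) * q (u - β)) : α = β := by
  have hint : ∀ a, ∫⁻ u, ENNReal.ofReal (q (u - a)) = 1 := fun a => by
    rw [lintegral_sub_right_eq_self fun u => ENNReal.ofReal (q u), hq.lintegral_eq_one]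
  set c := q (0 - α) / q (0 - β) with hc
  have hc0 : 0 ≤ c := (div_pos (hq.pos _) (hq.pos _)).le
  have hmul : ∀ u, q (u - α) = c * q (u - β) := fun u => by
    rw [hc, div_mul_eq_mul_div, eq_div_iff (hq.pos _).ne', h u 0]
  have hc1 : c = 1 := by
    have := hint α
    simp_rw [hmul, ENNReal.ofReal_mul hc0] at this
    rwa [lintegral_const_mul' _ _ ENNReal.ofReal_ne_top, hint β, mul_one,
      ENNReal.ofReal_eq_one] at this
  by_contra hne
  -- A continuous positive periodic function is bounded below by a positive constant, so its
  -- integral is infinite.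
  have hper : Function.Periodic q (β - α) := fun u => by
    have := hmul (u + β)
    rw [hc1, one_mul, add_sub_cancel_right] at this
    rw [← this]
    ring_nf
  have hcomp := hper.compact_of_continuous (sub_ne_zero.2 (Ne.symm hne)) hq.continuous
  obtain ⟨_, ⟨m, rfl⟩, hm⟩ := hcomp.exists_isLeast (Set.range_nonempty q)
  have hle : ∫⁻ _ : ℝ, ENNReal.ofReal (q m) ≤ ∫⁻ u, ENNReal.ofReal (q u) :=
    lintegral_mono fun u => ENNReal.ofReal_le_ofReal (hm ⟨u, rfl⟩)
  rw [lintegral_const, Real.volume_univ, hq.lintegral_eq_one,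
    ENNReal.mul_top (by simpa using hq.pos m)] at hle
  exact absurd hle (by simp)

/-! ### Sources and sinks of finite DAGs -/

/-- A non-empty finite set of vertices of a DAG contains a vertex with no parent in the set. -/
theorem Digraph.IsDAG.exists_source {V : Type*} [Finite V] {G : Digraph V} (hG : G.IsDAG)
    {E : Finset V} (hE : E.Nonempty) : ∃ s ∈ E, ∀ i ∈ E, ¬ Relation.TransGen G.Adj i s := by
  have : Std.Irrefl (Relation.TransGen G.Adj) := ⟨hG⟩
  exact (Finite.wellFounded_of_trans_of_irrefl (Relation.TransGen G.Adj)).has_min (E : Set V) hE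

/-- A non-empty finite set of vertices of a DAG contains a vertex with no child in the set. -/
theorem Digraph.IsDAG.exists_sink {V : Type*} [Finite V] {G : Digraph V} (hG : G.IsDAG)
    {E : Finset V} (hE : E.Nonempty) : ∃ s ∈ E, ∀ i ∈ E, ¬ Relation.TransGen G.Adj s i := by
  have : Std.Irrefl (Function.swap (Relation.TransGen G.Adj)) := ⟨hG⟩
  exact (Finite.wellFounded_of_trans_of_irrefl
    (Function.swap (Relation.TransGen G.Adj))).has_min (E : Set V) hE

/-! ### Products of densities -/

/-- The Lebesgue integral of a product of functions of one coordinate each. -/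
theorem MeasureTheory.lintegral_prod_coord {ι : Type*} [Fintype ι] [DecidableEq ι]
    {f : ι → ℝ → ℝ≥0∞} (hf : ∀ i, Measurable (f i)) :
    ∫⁻ x : ι → ℝ, ∏ i, f i (x i) = ∏ i, ∫⁻ t, f i t := by
  have hmeas : Measurable fun x : ι → ℝ => ∏ i, f i (x i) :=
    Finset.measurable_fun_prod _ fun i _ => (hf i).comp (measurable_pi_apply i)
  have key : ∀ (s : Finset ι) (x : ι → ℝ),
      lmarginal (fun _ => volume) s (fun x => ∏ i, f i (x i)) x =
        (∏ i ∈ s, ∫⁻ t, f i t) * ∏ i ∈ sᶜ, f i (x i) := by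
    intro s
    induction s using Finset.induction_on with
    | empty => simp
    | insert a s ha ih =>
      intro x
      rw [lmarginal_insert _ hmeas ha]
      have hcompl : sᶜ = insert a (insert a s)ᶜ := by ext i; by_cases i = a <;> simp_all
      have hprod : ∀ t, ∏ i ∈ sᶜ, f i (Function.update x a t i) =
          f a t * ∏ i ∈ (insert a s)ᶜ, f i (x i) := by
        intro t
        rw [hcompl, Finset.prod_insert (by simp), Function.update_self]
        congr 1
        refine Finset.prod_congr rfl fun i hi => ?_
        rw [Function.update_of_ne]
        rintro rfl
        simp at hi
      simp_rw [ih, hprod]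
      rw [lintegral_const_mul _ ((hf a).mul_const _), lintegral_mul_const _ (hf a),
        Finset.prod_insert ha]
      ring
  have := key Finset.univ 0
  rw [volume_pi, lintegral_eq_lmarginal_univ 0, this]
  simp

/-- The product of measures with densities has the product of the densities as density. -/
theorem MeasureTheory.Measure.pi_withDensity {ι : Type*} [Fintype ι] {f : ι → ℝ → ℝ≥0∞}
    (hf : ∀ i, Measurable (f i)) [∀ i, SigmaFinite ((volume : Measure ℝ).withDensity (f i))] :
    Measure.pi (fun i => (volume : Measure ℝ).withDensity (f i)) =
      (volume : Measure (ι → ℝ)).withDensity fun x => ∏ i, f i (x i) := by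
  classical
  refine Measure.pi_eq fun s hs => ?_
  rw [withDensity_apply _ (MeasurableSet.univ_pi hs),
    ← lintegral_indicator (MeasurableSet.univ_pi hs)]
  have hint : ∀ i, (volume : Measure ℝ).withDensity (f i) (s i) =
      ∫⁻ t, (s i).indicator (f i) t := fun i => by
    rw [withDensity_apply _ (hs i), lintegral_indicator (hs i)]
  simp_rw [hint]
  rw [← lintegral_prod_coord fun i => (hf i).indicator (hs i)]
  congr 1
  funext x
  by_cases hx : x ∈ Set.univ.pi s
  · rw [Set.indicator_of_mem hx]
    exact Finset.prod_congr rfl fun i _ => (Set.indicator_of_mem (hx i (Set.mem_univ i)) _).symm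
  · rw [Set.indicator_of_notMem hx]
    obtain ⟨i, hi⟩ : ∃ i, x i ∉ s i := by simpa using hx
    exact (Finset.prod_eq_zero (Finset.mem_univ i) (Set.indicator_of_notMem hi _)).symm

/-! ### Factors and marginal densities -/

namespace AdditiveNoiseModel

variable {k : ℕ} (M : AdditiveNoiseModel k)

/-- The conditional density of the `j`-th variable given its parents. -/
noncomputable def factor (j : Fin k) (x : Fin k → ℝ) : ℝ := M.noiseDensity j (x j - M.f j x)

theorem not_adj_self (j : Fin k) : ¬ M.graph.Adj j j := fun h => M.isDAG j (.single h)

theorem factor_pos (j : Fin k) (x : Fin k → ℝ) : 0 < M.factor j x := (M.isPosDensity j).pos _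

theorem continuous_factor (j : Fin k) : Continuous (M.factor j) :=
  (M.isPosDensity j).continuous.comp ((continuous_apply j).sub (M.continuous_f j))

theorem measurable_ofReal_factor (j : Fin k) :
    Measurable fun x => ENNReal.ofReal (M.factor j x) :=
  (M.continuous_factor j).measurable.ennreal_ofReal

theorem jointDensity_eq (x : Fin k → ℝ) :
    M.jointDensity x = ∏ j, ENNReal.ofReal (M.factor j x) :=
  ENNReal.ofReal_prod_of_nonneg fun j _ => (M.factor_pos j x).le

theorem continuous_jointDensity : Continuous M.jointDensity :=
  ENNReal.continuous_ofReal.comp (continuous_finsetProd _ fun j _ => M.continuous_factor j)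

theorem factor_congr {j : Fin k} {x y : Fin k → ℝ} (hj : x j = y j)
    (h : ∀ i, M.graph.Adj i j → x i = y i) : M.factor j x = M.factor j y := by
  rw [factor, factor, hj, M.f_congr j x y h]

theorem f_update {i j : Fin k} (h : ¬ M.graph.Adj i j) (x : Fin k → ℝ) (t : ℝ) :
    M.f j (Function.update x i t) = M.f j x :=
  M.f_congr j _ _ fun m hm => Function.update_of_ne (by rintro rfl; exact h hm) _ _

theorem factor_update {i j : Fin k} (hij : i ≠ j) (h : ¬ M.graph.Adj i j) (x : Fin k → ℝ) (t : ℝ) :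
    M.factor j (Function.update x i t) = M.factor j x := by
  rw [factor, factor, M.f_update h, Function.update_of_ne hij.symm]

theorem factor_update_self (j : Fin k) (x : Fin k → ℝ) (t : ℝ) :
    M.factor j (Function.update x j t) = M.noiseDensity j (t - M.f j x) := by
  rw [factor, M.f_update (M.not_adj_self j), Function.update_self]

theorem lintegral_factor (j : Fin k) (x : Fin k → ℝ) :
    ∫⁻ t, ENNReal.ofReal (M.factor j (Function.update x j t)) = 1 := by
  simp_rw [factor_update_self]
  rw [lintegral_sub_right_eq_self fun u => ENNReal.ofReal (M.noiseDensity j u),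
    (M.isPosDensity j).lintegral_eq_one]

/-- Integrating out a set of variables closed under taking children leaves the product of the
other factors. -/
theorem lmarginal_jointDensity {E : Finset (Fin k)}
    (hE : ∀ a b, a ∈ E → M.graph.Adj a b → b ∈ E) :
    lmarginal (fun _ => volume) E M.jointDensity =
      fun x => ∏ m ∈ Eᶜ, ENNReal.ofReal (M.factor m x) := by
  induction hn : E.card generalizing E with
  | zero =>
    rw [Finset.card_eq_zero] at hn
    subst hn
    funext x
    simp [jointDensity_eq]
  | succ n ih =>
    -- A source is integrated out last: its children lie in `E`, so only its own factor still
    -- contains `x_s`.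
    obtain ⟨s, hs, hsource⟩ := M.isDAG.exists_source (E := E) (Finset.card_pos.1 (by lia))
    have hE' : ∀ a b, a ∈ E.erase s → M.graph.Adj a b → b ∈ E.erase s := by
      intro a b ha hab
      have ha' := Finset.mem_of_mem_erase ha
      refine Finset.mem_erase.2 ⟨?_, hE a b ha' hab⟩
      rintro rfl
      exact hsource a ha' (.single hab)
    have ih' := ih hE' (by rw [Finset.card_erase_of_mem hs, hn]; rfl)
    funext x
    rw [lmarginal_erase _ M.continuous_jointDensity.measurable hs, ih']
    have hcompl : (E.erase s)ᶜ = insert s Eᶜ := by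
      ext i; by_cases i = s <;> simp_all
    have hprod : ∀ t, ∏ m ∈ (E.erase s)ᶜ, ENNReal.ofReal (M.factor m (Function.update x s t)) =
        ENNReal.ofReal (M.factor s (Function.update x s t)) *
          ∏ m ∈ Eᶜ, ENNReal.ofReal (M.factor m x) := by
      intro t
      rw [hcompl, Finset.prod_insert (by simpa using hs)]
      congr 1
      refine Finset.prod_congr rfl fun m hm => ?_
      rw [Finset.mem_compl] at hm
      rw [M.factor_update (by rintro rfl; exact hm hs) fun h => hm (hE s m hs h)]
    simp_rw [hprod]
    rw [lintegral_mul_const, M.lintegral_factor, one_mul]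
    exact (M.measurable_ofReal_factor s).comp (measurable_update x)

/-- The marginal density of non-descendants of `j` that include the parents of `j`, together with
the `j`-th variable. -/
theorem marginalDensity_insert {j : Fin k} {T : Finset (Fin k)}
    (hpa : ∀ i, M.graph.Adj i j → i ∈ T) (hj : j ∉ T)
    (hnd : ∀ m ∈ T, ¬ Relation.TransGen M.graph.Adj j m) (x : Fin k → ℝ) :
    M.marginalDensity (insert j T) x = M.marginalDensity T x * ENNReal.ofReal (M.factor j x) := by
  classical
  set D : Finset (Fin k) := Finset.univ.filter fun m => Relation.TransGen M.graph.Adj j m with hD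
  have hmD : ∀ m, m ∈ D ↔ Relation.TransGen M.graph.Adj j m := fun m => by simp [hD]
  -- The descendants `D` of `j` are integrated out first, with or without `j`. The factor of `j`
  -- does not contain the variables in `W` and leaves the remaining integral.
  set W : Finset (Fin k) := (insert j T)ᶜ \ D with hW
  have hjD : j ∉ D := fun h => M.isDAG j ((hmD j).1 h)
  have hTD : ∀ m ∈ T, m ∉ D := fun m hm h => hnd m hm ((hmD m).1 h)
  have e1 : (insert j T)ᶜ = W ∪ D := by
    ext m
    have := hTD m
    by_cases hmj : m = j
    · subst hmj; simp [hW, hj, hjD]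
    · by_cases hmD' : m ∈ D
      · simpa [hW, hmj, hmD'] using fun h => this h hmD'
      · simp [hW, hmj, hmD']
  have e2 : Tᶜ = W ∪ insert j D := by
    ext m
    have := hTD m
    by_cases hmj : m = j
    · subst hmj; simp [hW, hj, hjD]
    · by_cases hmD' : m ∈ D
      · simpa [hW, hmj, hmD'] using fun h => this h hmD'
      · simp [hW, hmj, hmD']
  have d1 : Disjoint W D := Finset.sdiff_disjoint
  have d2 : Disjoint W (insert j D) := by
    rw [Finset.disjoint_insert_right]
    exact ⟨fun h => by simp [hW] at h, d1⟩
  have hmeas := M.continuous_jointDensity.measurable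
  have hcompl : Dᶜ = insert j (insert j D)ᶜ := by
    ext i
    by_cases hij : i = j
    · subst hij; simp [hjD]
    · simp [hij]
  rw [marginalDensity, marginalDensity, e1, e2, lmarginal_union _ _ hmeas d1,
    lmarginal_union _ _ hmeas d2, M.lmarginal_jointDensity, M.lmarginal_jointDensity]
  · rw [hcompl, mul_comm]
    simp_rw [Finset.prod_insert (show j ∉ (insert j D)ᶜ by simp)]
    simp only [lmarginal]
    rw [← lintegral_const_mul]
    · refine lintegral_congr fun y => ?_
      have hnot : ∀ i ∈ insert j T, Function.updateFinset x W y i = x i := fun i hi => by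
        rw [Function.updateFinset, dif_neg]
        exact fun h => (Finset.mem_compl.1 (Finset.mem_sdiff.1 h).1) hi
      rw [M.factor_congr (hnot j (Finset.mem_insert_self _ _)) fun i hi =>
        hnot i (Finset.mem_insert_of_mem (hpa i hi))]
    · exact (Finset.measurable_fun_prod _ fun i _ => M.measurable_ofReal_factor i).comp
        measurable_updateFinset
  · intro a b ha hab
    rcases Finset.mem_insert.1 ha with rfl | ha
    · exact Finset.mem_insert_of_mem ((hmD b).2 (.single hab))
    · exact Finset.mem_insert_of_mem ((hmD b).2 (((hmD a).1 ha).tail hab))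
  · intro a b ha hab
    exact (hmD b).2 (((hmD a).1 ha).tail hab)

/-! ### The law of the model by change of variables to the noise -/

/-- The noise values that belong to a value of the random vector, in the coordinates in `E`. -/
def noise (E : Finset (Fin k)) (x : Fin k → ℝ) (j : Fin k) : ℝ :=
  if j ∈ E then x j - M.f j x else x j

theorem continuous_noise (E : Finset (Fin k)) : Continuous (M.noise E) := by
  refine continuous_pi fun j => ?_
  by_cases hj : j ∈ E
  · simp only [noise, hj, if_true]
    exact (continuous_apply j).sub (M.continuous_f j)
  · simpa [noise, hj] using continuous_apply j

theorem noise_insert {E : Finset (Fin k)} {s : Fin k} (hs : s ∉ E)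
    (hsource : ∀ i ∈ E, ¬ M.graph.Adj i s) :
    M.noise (insert s E) = M.noise {s} ∘ M.noise E := by
  funext x j
  by_cases hj : j = s
  · subst hj
    have : M.f j (M.noise E x) = M.f j x := M.f_congr j _ _ fun i hi => by
      have : i ∉ E := fun h => hsource i h hi
      simp [noise, this]
    simp [noise, ← this]
    simp [this, hs]
  · simp [noise, hj]

theorem noise_singleton (s : Fin k) (x : Fin k → ℝ) :
    M.noise {s} x = Function.update x s (x s - M.f s x) := by
  funext j
  by_cases hj : j = s
  · subst hj
    simp [noise]
  · simp [noise, hj]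

/-- A shear: `x_s` is translated by an amount that does not depend on `x_s`. -/
theorem measurePreserving_noise_singleton (s : Fin k) :
    MeasurePreserving (M.noise {s}) volume volume := by
  refine ⟨(M.continuous_noise _).measurable, ?_⟩
  refine Measure.ext_of_lintegral _ fun h hh => ?_
  have hm := (M.continuous_noise {s}).measurable
  rw [lintegral_map hh hm, volume_pi]
  refine lintegral_eq_of_lmarginal_eq {s} (hh.comp hm) hh ?_
  funext x
  simp only [lmarginal_singleton, noise_singleton, Function.update_idem,
    Function.update_self, M.f_update (M.not_adj_self s)]
  exact lintegral_sub_right_eq_self (fun u => h (Function.update x s u)) _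

theorem injective_noise_singleton (s : Fin k) : Function.Injective (M.noise {s}) := by
  intro x y hxy
  have hne : ∀ j, j ≠ s → x j = y j := fun j hj => by
    simpa [noise, hj] using congrFun hxy j
  have hf : M.f s x = M.f s y := M.f_congr s _ _ fun i hi =>
    hne i (by rintro rfl; exact M.not_adj_self _ hi)
  funext j
  by_cases hj : j = s
  · subst hj
    simpa [noise, hf] using congrFun hxy j
  · exact hne j hj

/-- The passage to the noise is a composition of shears, one vertex at a time. -/
theorem noise_induction (E : Finset (Fin k)) :
    MeasurePreserving (M.noise E) volume volume ∧ Function.Injective (M.noise E) := by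
  induction hn : E.card generalizing E with
  | zero =>
    rw [Finset.card_eq_zero] at hn
    have : M.noise E = id := by
      funext x j
      simp [noise, hn]
    rw [this]
    exact ⟨.id _, Function.injective_id⟩
  | succ n ih =>
    obtain ⟨s, hs, hsource⟩ := M.isDAG.exists_source (E := E) (Finset.card_pos.1 (by lia))
    obtain ⟨h1, h2⟩ := ih (E.erase s) (by rw [Finset.card_erase_of_mem hs, hn]; rfl)
    rw [← Finset.insert_erase hs, M.noise_insert (Finset.notMem_erase s E) fun i hi h =>
      hsource i (Finset.mem_of_mem_erase hi) (.single h)]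
    exact ⟨(M.measurePreserving_noise_singleton s).comp h1,
      (M.injective_noise_singleton s).comp h2⟩

/-- The law of a random vector generated by an additive noise model has the joint density of the
model. -/
theorem Generates.map_eq {M : AdditiveNoiseModel k} {Ω : Type*} [MeasurableSpace Ω]
    {μ : Measure Ω} [IsProbabilityMeasure μ] {C : Ω → Fin k → ℝ} (hC : M.Generates μ C) :
    μ.map C = volume.withDensity M.jointDensity := by
  obtain ⟨hCm, ε, hε, hind, hlaw, heq⟩ := hC
  obtain ⟨hpres, hinj⟩ := M.noise_induction Finset.univ
  have hcont := M.continuous_noise Finset.univ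
  have hemb : MeasurableEmbedding (M.noise Finset.univ) := hcont.measurableEmbedding hinj
  have hdm : ∀ j, Measurable fun t => ENNReal.ofReal (M.noiseDensity j t) := fun j =>
    (M.isPosDensity j).continuous.measurable.ennreal_ofReal
  have : ∀ j, IsProbabilityMeasure
      ((volume : Measure ℝ).withDensity fun t => ENNReal.ofReal (M.noiseDensity j t)) := fun j =>
    hlaw j ▸ Measure.isProbabilityMeasure_map (hε j).aemeasurable
  have h1 : (μ.map C).map (M.noise Finset.univ) =
      volume.withDensity fun e => ∏ j, ENNReal.ofReal (M.noiseDensity j (e j)) := by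
    rw [Measure.map_map hcont.measurable hCm, ← Measure.pi_withDensity hdm]
    simp_rw [← hlaw]
    rw [← (iIndepFun_iff_map_fun_eq_pi_map fun j => (hε j).aemeasurable).1 hind]
    refine Measure.map_congr ?_
    filter_upwards [heq] with ω hω
    funext j
    have := hω j
    simp only [Function.comp_apply, noise, Finset.mem_univ, if_true]
    linarith
  have h2 : (volume.withDensity M.jointDensity).map (M.noise Finset.univ) =
      volume.withDensity fun e => ∏ j, ENNReal.ofReal (M.noiseDensity j (e j)) := by
    have hρ : Measurable fun e : Fin k → ℝ => ∏ j, ENNReal.ofReal (M.noiseDensity j (e j)) :=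
      Finset.measurable_fun_prod _ fun j _ => (hdm j).comp (measurable_pi_apply j)
    ext s hs
    rw [Measure.map_apply hcont.measurable hs, withDensity_apply _ (hcont.measurable hs),
      withDensity_apply _ hs, ← hpres.setLIntegral_comp_preimage hs hρ]
    refine lintegral_congr fun x => ?_
    simp [jointDensity_eq, factor, noise]
  -- A measure is determined by its image under a measurable embedding.
  rw [← hemb.comap_map (μ.map C), h1, ← h2, hemb.comap_map]

/-- Models that generate the same distribution have the same joint density. -/
theorem jointDensity_eq_of_withDensity_eq {M N : AdditiveNoiseModel k}
    (h : (volume : Measure (Fin k → ℝ)).withDensity M.jointDensity =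
      volume.withDensity N.jointDensity) : M.jointDensity = N.jointDensity := by
  rw [withDensity_eq_iff_of_sigmaFinite M.continuous_jointDensity.aemeasurable
    N.continuous_jointDensity.aemeasurable] at h
  exact (M.continuous_jointDensity.ae_eq_iff_eq _ N.continuous_jointDensity).1 h

end AdditiveNoiseModel

/-! ### Pruning and reversed edges -/

namespace AdditiveNoiseModel

variable {k : ℕ}

/-- The model in which only those edges `i → j` are kept for which `f_j` depends on `x_i`. -/
def prune (M : AdditiveNoiseModel k) : AdditiveNoiseModel k where
  graph := ⟨fun i j => ∃ x t, M.f j (Function.update x i t) ≠ M.f j x⟩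
  isDAG v h := M.isDAG v <| Relation.TransGen.mono (fun i j ⟨x, t, hne⟩ => by
    by_contra hadj
    exact hne (M.f_update hadj x t)) v v h
  f := M.f
  continuous_f := M.continuous_f
  f_congr j x y h := by
    -- Pass from `x` to `y` one coordinate at a time.
    have key : ∀ s : Finset (Fin k), M.f j (s.piecewise y x) = M.f j x := by
      intro s
      induction s using Finset.induction_on with
      | empty => simp
      | insert a s _ ih =>
        rw [Finset.piecewise_insert, ← ih]
        by_cases hax : x a = y a
        · congr 1
          rw [Function.update_eq_self_iff]
          by_cases ha : a ∈ s <;> simp [ha, hax]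
        · by_contra hne
          exact hax (h a ⟨_, _, hne⟩)
    simpa using (key Finset.univ).symm
  noiseDensity := M.noiseDensity
  isPosDensity := M.isPosDensity

/-- In a restricted model every `f_j` depends on every parent of `j`. -/
theorem IsRestricted.exists_ne {M : AdditiveNoiseModel k} (hM : M.IsRestricted) {i j : Fin k}
    (h : M.graph.Adj i j) : ∃ x t, M.f j (Function.update x i t) ≠ M.f j x := by
  classical
  obtain ⟨x, -, -, -, -, -, -, -, hode⟩ := hM.2 i j h
    (Finset.univ.filter fun m => M.graph.Adj m j ∧ m ≠ i)
    (fun m hm hmi => by simp [hm, hmi]) (fun m hm => by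
      obtain ⟨hmj, hmi⟩ := (Finset.mem_filter.1 hm).2
      refine ⟨hmi, ?_, fun hd => M.isDAG j (hd.tail hmj)⟩
      rintro rfl
      exact M.not_adj_self _ hmj)
  by_contra! hcon
  -- If `f_j` did not depend on `x_i`, its derivative would vanish and the equation would hold
  -- vacuously.
  refine hode fun s t hst => absurd ?_ hst
  simp [hcon, iteratedDeriv_one]

/-- The edge `i → j` of a restricted model is not reversed in another model with the same joint
density, provided that the other parents of the two vertices are not descendants. -/
theorem IsRestricted.not_adj_reverse {M N : AdditiveNoiseModel k} (hM : M.IsRestricted)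
    (hMN : M.jointDensity = N.jointDensity) {i j : Fin k} (hij : M.graph.Adj i j)
    (hMnd : ∀ m, N.graph.Adj m i → ¬ Relation.TransGen M.graph.Adj j m)
    (hNnd : ∀ m, M.graph.Adj m j → ¬ Relation.TransGen N.graph.Adj i m) :
    ¬ N.graph.Adj j i := by
  classical
  intro hji
  have hne : i ≠ j := by
    rintro rfl
    exact M.not_adj_self _ hij
  set S : Finset (Fin k) :=
    Finset.univ.filter fun m => m ≠ i ∧ m ≠ j ∧ (M.graph.Adj m j ∨ N.graph.Adj m i) with hS
  have hmem : ∀ m, m ∈ S ↔ m ≠ i ∧ m ≠ j ∧ (M.graph.Adj m j ∨ N.graph.Adj m i) := fun m => by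
    simp [hS]
  have hSM : ∀ m ∈ S, ¬ Relation.TransGen M.graph.Adj j m := fun m hm hd => by
    rcases ((hmem m).1 hm).2.2 with h | h
    · exact M.isDAG j (hd.tail h)
    · exact hMnd m h hd
  have hSN : ∀ m ∈ S, ¬ Relation.TransGen N.graph.Adj i m := fun m hm hd => by
    rcases ((hmem m).1 hm).2.2 with h | h
    · exact hNnd m h hd
    · exact N.isDAG i (hd.tail h)
  obtain ⟨x, hx0, hxtop, hbiv⟩ := hM.2 i j hij S
    (fun m hm hmi => (hmem m).2 ⟨hmi, fun h => M.not_adj_self j (h ▸ hm), .inl hm⟩)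
    (fun m hm => ⟨((hmem m).1 hm).1, ((hmem m).1 hm).2.1, hSM m hm⟩)
  have hiS : i ∉ S := fun h => ((hmem i).1 h).1 rfl
  have hjS : j ∉ S := fun h => ((hmem j).1 h).2.1 rfl
  have hmarg : ∀ T y, M.marginalDensity T y = N.marginalDensity T y := fun T y => by
    rw [marginalDensity, marginalDensity, hMN]
  have hMeq : ∀ s t, M.marginalDensity (insert j (insert i S))
      (Function.update (Function.update x i s) j t) =
      M.marginalDensity (insert i S) (Function.update x i s) *
        ENNReal.ofReal (M.noiseDensity j (t - M.f j (Function.update x i s))) := by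
    intro s t
    rw [M.marginalDensity_insert, M.factor_update_self, marginalDensity,
      lmarginal_update_of_mem _ (by simp [hne.symm, hjS]), ← marginalDensity]
    · intro m hm
      by_cases hmi : m = i
      · simp [hmi]
      · exact Finset.mem_insert_of_mem
          ((hmem m).2 ⟨hmi, fun h => M.not_adj_self j (h ▸ hm), .inl hm⟩)
    · simp [hne.symm, hjS]
    · intro m hm
      rcases Finset.mem_insert.1 hm with rfl | hm
      · exact fun hd => M.isDAG j (hd.tail hij)
      · exact hSM m hm
  have hNeq : ∀ s t, N.marginalDensity (insert j (insert i S))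
      (Function.update (Function.update x i s) j t) =
      N.marginalDensity (insert j S) (Function.update x j t) *
        ENNReal.ofReal (N.noiseDensity i (s - N.f i (Function.update x j t))) := by
    intro s t
    rw [Finset.insert_comm, Function.update_comm hne, N.marginalDensity_insert,
      N.factor_update_self, marginalDensity,
      lmarginal_update_of_mem _ (by simp [hne, hiS]), ← marginalDensity]
    · intro m hm
      by_cases hmj : m = j
      · simp [hmj]
      · exact Finset.mem_insert_of_mem
          ((hmem m).2 ⟨fun h => N.not_adj_self i (h ▸ hm), hmj, .inr hm⟩)
    · simp [hne, hiS]
    · intro m hm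
      rcases Finset.mem_insert.1 hm with rfl | hm
      · exact fun hd => N.isDAG i (hd.tail hji)
      · exact hSN m hm
  -- Both factorizations of the marginal on `S ∪ {i, j}`, divided by the density at `x_S`, give the
  -- forward and the backward model.
  refine not_bivariateCondition_of_backward (g := fun t => N.f i (Function.update x j t))
    (r := N.noiseDensity i)
    (η := fun t => (N.marginalDensity (insert j S) (Function.update x j t)).toReal /
      (M.marginalDensity S x).toReal)
    ((N.continuous_f i).comp (continuous_const.update j continuous_id))
    (N.isPosDensity i).pos (fun s t => ?_) hbiv
  have h := congrArg ENNReal.toReal ((hMeq s t).symm.trans ((hmarg _ _).trans (hNeq s t)))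
  rw [ENNReal.toReal_mul, ENNReal.toReal_mul, ENNReal.toReal_ofReal ((M.isPosDensity j).pos _).le,
    ENNReal.toReal_ofReal ((N.isPosDensity i).pos _).le] at h
  rw [condDensity, ENNReal.toReal_div, div_mul_eq_mul_div, h, mul_div_right_comm]

/-! ### Detecting edges in products of factors -/

/-- The factor of `m` involves the variable `a`. -/
def Involves (M : AdditiveNoiseModel k) (m a : Fin k) : Prop := a = m ∨ M.graph.Adj a m

theorem factor_update_of_not_involves {M : AdditiveNoiseModel k} {m a : Fin k}
    (h : ¬ M.Involves m a) (x : Fin k → ℝ) (t : ℝ) :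
    M.factor m (Function.update x a t) = M.factor m x :=
  M.factor_update (fun h' => h (.inl h')) (fun h' => h (.inr h')) x t

/-- A product of factors, none of which involves both `a` and `b`, splits. -/
theorem prod_factor_mul_prod_factor {M : AdditiveNoiseModel k} {V : Finset (Fin k)} {a b : Fin k}
    (hab : a ≠ b) (h : ∀ m ∈ V, ¬ (M.Involves m a ∧ M.Involves m b)) (x : Fin k → ℝ)
    (s s' u u' : ℝ) :
    (∏ m ∈ V, M.factor m (Function.update (Function.update x a s) b u)) *
      (∏ m ∈ V, M.factor m (Function.update (Function.update x a s') b u')) =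
    (∏ m ∈ V, M.factor m (Function.update (Function.update x a s) b u')) *
      ∏ m ∈ V, M.factor m (Function.update (Function.update x a s') b u) := by
  rw [← Finset.prod_mul_distrib, ← Finset.prod_mul_distrib]
  refine Finset.prod_congr rfl fun m hm => ?_
  by_cases hb : M.Involves m b
  · have ha : ¬ M.Involves m a := fun ha => h m hm ⟨ha, hb⟩
    simp only [Function.update_comm hab, factor_update_of_not_involves ha]
    ring
  · simp only [factor_update_of_not_involves hb]

/-- If `f_b` depends on `x_a` and no other factor involves both variables, then some factor of
another factorization of the same function involves both. -/
theorem exists_involves {M N : AdditiveNoiseModel k} {V : Finset (Fin k)}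
    (hV : ∀ x, ∏ m ∈ V, M.factor m x = ∏ m ∈ V, N.factor m x) {a b : Fin k} (hb : b ∈ V)
    (hdep : ∃ x t, M.f b (Function.update x a t) ≠ M.f b x)
    (hM : ∀ m ∈ V, m ≠ b → ¬ (M.Involves m a ∧ M.Involves m b)) :
    ∃ m ∈ V, N.Involves m a ∧ N.Involves m b := by
  classical
  by_contra! hN
  obtain ⟨x, t, hne⟩ := hdep
  have hab : a ≠ b := by
    rintro rfl
    exact hne (M.f_update (M.not_adj_self a) x t)
  refine hne ((M.isPosDensity b).eq_of_mul_eq_mul fun u v => ?_)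
  -- Exchange `u` and `v` in the full product and in the product without the factor of `b`; the
  -- quotient is the relation between translates of the noise density of `b`.
  have hN' := prod_factor_mul_prod_factor (V := V) (M := N) hab
    (fun m hm h => hN m hm h.1 h.2) x t (x a) u v
  have hM' := prod_factor_mul_prod_factor (V := V.erase b) (M := M) hab
    (fun m hm => hM m (Finset.mem_of_mem_erase hm) (Finset.ne_of_mem_erase hm)) x t (x a) u v
  simp only [← hV, ← Finset.mul_prod_erase V _ hb, factor_update_self,
    Function.update_eq_self] at hN' hM'
  have hpos : ∀ y, 0 < ∏ m ∈ V.erase b, M.factor m y := fun y =>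
    Finset.prod_pos fun m _ => M.factor_pos m y
  rw [mul_mul_mul_comm, mul_mul_mul_comm (M.noiseDensity b _) _ (M.noiseDensity b _), hM'] at hN'
  exact mul_right_cancel₀ (mul_pos (hpos _) (hpos _)).ne' hN'

/-- Equal products of factors remain equal if a vertex without children is dropped. -/
theorem prod_factor_erase {M N : AdditiveNoiseModel k} {V : Finset (Fin k)}
    (hV : ∀ x, ∏ m ∈ V, M.factor m x = ∏ m ∈ V, N.factor m x) {l : Fin k} (hl : l ∈ V)
    (hM : ∀ m ∈ V, ¬ M.graph.Adj l m) (hN : ∀ m ∈ V, ¬ N.graph.Adj l m) (x : Fin k → ℝ) :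
    ∏ m ∈ V.erase l, M.factor m x = ∏ m ∈ V.erase l, N.factor m x := by
  have key : ∀ L : AdditiveNoiseModel k, (∀ m ∈ V, ¬ L.graph.Adj l m) →
      ∫⁻ t, ENNReal.ofReal (∏ m ∈ V, L.factor m (Function.update x l t)) =
        ENNReal.ofReal (∏ m ∈ V.erase l, L.factor m x) := by
    intro L hL
    have : ∀ t, ENNReal.ofReal (∏ m ∈ V, L.factor m (Function.update x l t)) =
        ENNReal.ofReal (L.factor l (Function.update x l t)) *
          ENNReal.ofReal (∏ m ∈ V.erase l, L.factor m x) := by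
      intro t
      rw [← ENNReal.ofReal_mul (L.factor_pos _ _).le, ← Finset.mul_prod_erase V _ hl]
      congr 2
      refine Finset.prod_congr rfl fun m hm => ?_
      exact L.factor_update (Finset.ne_of_mem_erase hm).symm
        (hL m (Finset.mem_of_mem_erase hm)) x t
    simp_rw [this]
    rw [lintegral_mul_const' _ _ ENNReal.ofReal_ne_top, L.lintegral_factor, one_mul]
  have h := key M hM
  simp_rw [hV] at h
  rw [key N hN, ENNReal.ofReal_eq_ofReal_iff] at h
  · exact h.symm
  · exact Finset.prod_nonneg fun m _ => (N.factor_pos m x).le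
  · exact Finset.prod_nonneg fun m _ => (M.factor_pos m x).le

/-- A restricted model has no more edges than a pruned model with the same joint density. -/
theorem IsRestricted.adj_of_prod_factor_eq {M N : AdditiveNoiseModel k} (hM : M.IsRestricted)
    (hMN : M.jointDensity = N.jointDensity)
    (hN : ∀ i j, N.graph.Adj i j → ∃ x t, N.f j (Function.update x i t) ≠ N.f j x)
    {V : Finset (Fin k)} (hMV : ∀ a b, b ∈ V → M.graph.Adj a b → a ∈ V)
    (hNV : ∀ a b, b ∈ V → N.graph.Adj a b → a ∈ V)
    (hV : ∀ x, ∏ m ∈ V, M.factor m x = ∏ m ∈ V, N.factor m x) :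
    ∀ j ∈ V, ∀ i, M.graph.Adj i j → N.graph.Adj i j := by
  classical
  induction hn : V.card generalizing V with
  | zero =>
    rw [Finset.card_eq_zero] at hn
    simp [hn]
  | succ n ih =>
    obtain ⟨l, hl, hsink⟩ := M.isDAG.exists_sink (E := V) (Finset.card_pos.1 (by lia))
    have hMl : ∀ m ∈ V, ¬ M.graph.Adj l m := fun m hm h => hsink m hm (.single h)
    have hMinv : ∀ m ∈ V, m ≠ l → ∀ w, ¬ (M.Involves m w ∧ M.Involves m l) :=
      fun m hm hml w h => h.2.elim (fun e => hml e.symm) (hMl m hm)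
    by_cases hNl : ∀ m ∈ V, ¬ N.graph.Adj l m
    · have hpar : ∀ i, M.graph.Adj i l → N.graph.Adj i l := by
        intro i hil
        obtain ⟨m, hm, hi, hl'⟩ := exists_involves hV hl (hM.exists_ne hil)
          fun m hm hml => hMinv m hm hml i
        obtain rfl : l = m := hl'.resolve_right (hNl m hm)
        refine hi.resolve_left ?_
        rintro rfl
        exact M.not_adj_self _ hil
      intro j hj i hij
      by_cases hjl : j = l
      · subst hjl
        exact hpar i hij
      · refine ih (V := V.erase l) ?_ ?_ (prod_factor_erase hV hl hMl hNl)
          (by rw [Finset.card_erase_of_mem hl, hn]; rfl) j (Finset.mem_erase.2 ⟨hjl, hj⟩) i hij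
        · intro a b hb hab
          have hb' := Finset.mem_of_mem_erase hb
          exact Finset.mem_erase.2 ⟨fun h => hMl b hb' (h ▸ hab), hMV a b hb' hab⟩
        · intro a b hb hab
          have hb' := Finset.mem_of_mem_erase hb
          exact Finset.mem_erase.2 ⟨fun h => hNl b hb' (h ▸ hab), hNV a b hb' hab⟩
    · exfalso
      push Not at hNl
      obtain ⟨c, hc, hlc⟩ := hNl
      -- With `y` a last child of `l`, no other factor of `N` over `V` involves both `l` and `y`.
      obtain ⟨y, hy, hyoung⟩ := N.isDAG.exists_sink
        (E := V.filter fun m => N.graph.Adj l m) ⟨c, Finset.mem_filter.2 ⟨hc, hlc⟩⟩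
      obtain ⟨hyV, hly⟩ := Finset.mem_filter.1 hy
      have hyoung' : ∀ m ∈ V, N.graph.Adj l m → ¬ Relation.TransGen N.graph.Adj y m :=
        fun m hm h => hyoung m (Finset.mem_filter.2 ⟨hm, h⟩)
      have hyl : M.graph.Adj y l := by
        obtain ⟨m, hm, hlm, hym⟩ := exists_involves (M := N) (N := M) (fun x => (hV x).symm) hyV
          (hN l y hly) fun m hm hmy h => by
            have hym : N.graph.Adj y m := h.2.resolve_left (Ne.symm hmy)
            rcases h.1 with rfl | hlm
            · exact N.isDAG l (.tail (.single hly) hym)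
            · exact hyoung' m hm hlm (.single hym)
        obtain rfl : l = m := hlm.resolve_right (hMl m hm)
        refine hym.resolve_left ?_
        rintro rfl
        exact N.not_adj_self _ hly
      refine hM.not_adj_reverse hMN hyl (fun m hm => hsink m (hNV m y hyV hm)) ?_ hly
      -- Some factor `m` of `N` involves `w` and `l`. Either `m = l` and there is a cycle `l → y ⇝ w
      -- → l`, or `m` is a child of `l` and a descendant of `y`.
      intro w hwl hyw
      obtain ⟨m, hm, hwm, hlm⟩ := exists_involves hV hl (hM.exists_ne hwl)
        fun m hm hml => hMinv m hm hml w
      rcases hlm with rfl | hlm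
      · have hwl' : N.graph.Adj w l := hwm.resolve_left (by
          rintro rfl
          exact M.not_adj_self _ hwl)
        exact N.isDAG l ((Relation.TransGen.single hly).trans (hyw.tail hwl'))
      · rcases hwm with rfl | hwm
        · exact hyoung' w hm hlm hyw
        · exact hyoung' m hm hlm (hyw.tail hwm)

end AdditiveNoiseModel

theorem mainTheorem1 {k : ℕ} (M : AdditiveNoiseModel k) (hM : M.IsRestricted) (N : MaskedModel k)
    (P : Measure (Fin k → ℝ))
    {Ω : Type*} [MeasurableSpace Ω] (μ : Measure Ω) [IsProbabilityMeasure μ]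
    (C : Ω → Fin k → ℝ) (hC : M.Generates μ C) (hCP : μ.map C = P)
    {Ω' : Type*} [MeasurableSpace Ω'] (μ' : Measure Ω') [IsProbabilityMeasure μ']
    (C' : Ω' → Fin k → ℝ) (hC' : N.toAdditiveNoiseModel.Generates μ' C') (hCP' : μ'.map C' = P) :
    M.graph ≤ N.graph := by
  have hMN : M.jointDensity = N.toAdditiveNoiseModel.prune.jointDensity := by
    refine AdditiveNoiseModel.jointDensity_eq_of_withDensity_eq
      (N := N.toAdditiveNoiseModel.prune) ?_
    -- Pruning changes only the graph, hence not the density.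
    change _ = volume.withDensity N.toAdditiveNoiseModel.jointDensity
    rw [← hC.map_eq, ← hC'.map_eq, hCP, hCP']
  intro i j hij
  obtain ⟨x, t, hne⟩ := hM.adj_of_prod_factor_eq hMN (fun _ _ h => h) (V := Finset.univ)
    (fun _ _ _ _ => Finset.mem_univ _) (fun _ _ _ _ => Finset.mem_univ _) (fun x => by
      have h := congrFun hMN x
      rwa [AdditiveNoiseModel.jointDensity, AdditiveNoiseModel.jointDensity,
        ENNReal.ofReal_eq_ofReal_iff] at h
      · exact Finset.prod_nonneg fun m _ => (M.factor_pos m x).le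
      · exact Finset.prod_nonneg fun m _ =>
          (N.toAdditiveNoiseModel.prune.factor_pos m x).le) j (Finset.mem_univ j) i hij
  by_contra hadj
  exact hne (N.toAdditiveNoiseModel.f_update hadj x t)
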